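/- Fix $\eta>0$. A set $S\subset\mathbb{R}^2$ is called \emph{$\eta$-Gromov} if distinct points of $S$ are at distance $\ge\eta$ and $S$ is maximal, with respect to inclusion, among subsets of $\mathbb{R}^2$ with this property. A \emph{triangulation} of a point set $S\subset\mathbb{R}^2$ is a geometric simplicial complex with vertex set $S$ whose polyhedron is the convex hull of $S$; it is \emph{Delaunay} if the circumdisk of each of its triangles contains no point of $S$ in its interior. A \emph{maximal $\eta$-CDG} is a Delaunay triangulation of an $\eta$-Gromov subset of $\mathbb{R}^2$, and an \emph{$\eta$-CDG} is a subcomplex of a maximal $\eta$-CDG. A segment between two points of $S$ is in the \emph{Delaunay graph} of $S$ if it is an edge of every Delaunay triangulation of $S$. A segment $ab$ between two points of a discrete set $S\subset\mathbb{R}^2$ is \emph{$\delta$-stable} (relative to $S$) if for every embedding $\iota:S\to\mathbb{R}^2$ with $|\iota(x)-x|<\delta$ for all $x\in S$, the segment $\iota(a)\iota(b)$ is in the Delaunay graph of $\iota(S)$. A \emph{boundary edge} of a complex $\mathcal{T}$ in $\mathbb{R}^2$ is an edge of $\mathcal{T}$ that lies in at most one triangle of $\mathcal{T}$. We write $|\mathcal{T}|$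 for the polyhedron of $\mathcal{T}$ and $B(A,r)$ for the set of points at distance $<r$ from some point of $A$. \textbf{Proposition.} There is a universal constant $\xi>0$ with the following property. Let $\eta>0$ and let $\mathcal{T}$ be an $\eta$-CDG which is a subcomplex of a maximal $\eta$-CDG $\mathcal{T}_{\max}$. Then there is an $\eta$-CDG $\mathcal{T}_{\mathrm{st}}$ such that $$\mathcal{T}\subset\mathcal{T}_{\mathrm{st}}\subset\mathcal{T}_{\max},\qquad |\mathcal{T}_{\mathrm{st}}|\subset B(|\mathcal{T}|,2\eta),$$ and every boundary edge of $\mathcal{T}_{\mathrm{st}}$ is $\xi\eta$-stable relative to the vertex set of $\mathcal{T}_{\max}$. -/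

import Mathlib

namespace CDG

/-- The Euclidean plane. -/
abbrev Plane : Type := EuclideanSpace ℝ (Fin 2)

/-- A geometric simplicial complex in the plane. -/
abbrev Complex2 : Type := Geometry.SimplicialComplex ℝ Plane

/-- `Y` is `η`-separated: distinct points of `Y` are at distance at least `η`. -/
def IsEtaSeparated {X : Type*} [MetricSpace X] (η : ℝ) (Y : Set X) : Prop :=
  Y.Pairwise fun a b => η ≤ dist a b

/-- `Y` is an `η`-Gromov subset of `X`: it is `η`-separated and not properly contained in any
`η`-separated subset of `X`. -/
def IsGromov {X : Type*} [MetricSpace X] (η : ℝ) (Y : Set X) : Prop :=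
  Maximal (IsEtaSeparated η) Y

/-- `T` triangulates the point set `S`: its vertex set is `S`, and its polyhedron is the convex
hull of `S` (the whole plane when `S` is a Gromov subset of the plane). -/
def IsTriangulationOf (T : Complex2) (S : Set Plane) : Prop :=
  T.vertices = S ∧ T.space = convexHull ℝ S

/-- `T` is a Delaunay triangulation of `S`: it triangulates `S`, and the circumdisk of each
triangle of `T` (the disk whose boundary circle, with center `c` and radius `r`, passes through
the three vertices) has no point of `S` in its interior. -/
def IsDelaunay (T : Complex2) (S : Set Plane) : Prop :=
  IsTriangulationOf T S ∧
    ∀ t ∈ T.faces, t.card = 3 → ∀ (c : Plane) (r : ℝ), (∀ v ∈ t, dist v c = r) →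
      ∀ p ∈ S, ¬ dist p c < r

/-- `T` is a maximal `η`-CDG: a Delaunay triangulation of an `η`-Gromov subset of the plane. -/
def IsMaximalCDG (η : ℝ) (T : Complex2) : Prop :=
  ∃ S : Set Plane, IsGromov η S ∧ IsDelaunay T S

/-- `T` is an `η`-CDG: a subcomplex of a Delaunay triangulation of an `η`-Gromov subset of the
plane. -/
def IsCDG (η : ℝ) (T : Complex2) : Prop :=
  ∃ T' : Complex2, IsMaximalCDG η T' ∧ T ≤ T'

/-- The segment with distinct endpoints `a`, `b` is an edge of `T`. -/
def HasEdge (T : Complex2) (a b : Plane) : Prop :=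
  a ≠ b ∧ ∃ e ∈ T.faces, (e : Set Plane) = {a, b}

/-- The segment `ab` is in the Delaunay graph of `S`: it joins two points of `S`, and it is an
edge of every Delaunay triangulation of `S`. -/
def InDelaunayGraph (S : Set Plane) (a b : Plane) : Prop :=
  a ∈ S ∧ b ∈ S ∧ ∀ T : Complex2, IsDelaunay T S → HasEdge T a b

/-- The segment `ab` between two points of `S` is `ξ`-stable (relative to `S`): for every
embedding `ι` of `S` in the plane that moves the points of `S` by less than `ξ`, the segment
`ι(a)ι(b)` is in the Delaunay graph of `ι(S)`. -/
def IsStable (ξ : ℝ) (S : Set Plane) (a b : Plane) : Prop :=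
  ∃ (ha : a ∈ S) (hb : b ∈ S), ∀ ι : S → Plane, Topology.IsEmbedding ι →
    (∀ x : S, dist (ι x) (x : Plane) < ξ) →
      InDelaunayGraph (Set.range ι) (ι ⟨a, ha⟩) (ι ⟨b, hb⟩)

/-- The segment `ab` is a boundary edge of `T`: it is an edge of `T` that lies in at most one
triangle of `T`. -/
def IsBoundaryEdge (T : Complex2) (a b : Plane) : Prop :=
  HasEdge T a b ∧ {t | t ∈ T.faces ∧ t.card = 3 ∧ a ∈ t ∧ b ∈ t}.Subsingleton

end CDG

/-!
Let `S` be the vertex set of `Tmax`. Since `S` is `η`-separated and meets every disk of radius `η`,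
the circumdisks of the triangles of `Tmax` have radius less than `η`.

Suppose that two triangles of `Tmax` share an edge `ab` and that their circumcenters are at
distance at least `ε * η`. Neither circumdisk contains a point of `S` in its interior, and the power
of a point with respect to the circle through `a` and `b` centered midway between the two
circumcenters is the average of its powers with respect to the two circumcircles. It follows that
this intermediate disk keeps all points of `S` other than `a`, `b` at a definite distance
(`exists_protecting_disk`). After a small perturbation of `S` there is still a disk through the two
perturbed endpoints that contains no other point, and such a pair of points is an edge of every
Delaunay triangulation (`IsDelaunay.hasEdge_of_empty_disk`). So the edge `ab` is stable
(`isStable_of_protecting_disk`).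

Consequently, two triangles that share an unstable edge have circumcenters at distance at most
`ε * η`. The triangles with circumcenter within `η / 10` of a given point have their vertices in a
disk of radius `2 * η`, so their number is bounded by a universal constant `N`. With
`ε = 1 / (10 * N)`, a chain of triangles each of which shares an unstable edge with the next cannot
leave this neighborhood (`dist_le_of_reflTransGen`, `exists_dist_circumcenter_le`).

The complex `stableHull` is obtained from `T` by adding all triangles reached by such chains from
the unstable edges of `T`. An unstable edge of this complex lies in two triangles of `Tmax`, one on
each side (`IsDelaunay.exists_two_triangles`), and both have been added, so it is not a boundary
edge. The added triangles lie within `2 * η` of `T`: a chain starts at an edge of `T` of length at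
least `η`, whose midpoint is within `√3 / 2 * η` of the first circumcenter, and this is within
`η / 10` of the last circumcenter, the points of the last triangle being within `η` of the latter.
-/

namespace CDG

/-! ### Coordinates, separated sets and nets -/

/-- `S` is a `ρ`-net: every point of the plane is at distance less than `ρ` from `S`. -/
def IsNet (ρ : ℝ) (S : Set Plane) : Prop :=
  ∀ p, ∃ s ∈ S, dist p s < ρ

theorem dist_sq_eq (p q : Plane) : dist p q ^ 2 = (p 0 - q 0) ^ 2 + (p 1 - q 1) ^ 2 := by
  rw [EuclideanSpace.dist_eq, Real.sq_sqrt (by positivity)]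
  simp [Fin.sum_univ_two, Real.dist_eq]

/-- Cartesian coordinates with origin `a` whose first axis passes through `b`. -/
theorem exists_frame {a b : Plane} (hab : a ≠ b) :
    ∃ X Y : Plane → ℝ, (∀ p q, dist p q ^ 2 = (X p - X q) ^ 2 + (Y p - Y q) ^ 2) ∧
      X a = 0 ∧ Y a = 0 ∧ X b = dist a b ∧ Y b = 0 ∧
      ∀ p q, X (midpoint ℝ p q) = (X p + X q) / 2 ∧ Y (midpoint ℝ p q) = (Y p + Y q) / 2 := by
  have hL : dist a b ≠ 0 := dist_ne_zero.2 hab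
  have hL2 := dist_sq_eq a b
  have hm : ∀ (p q : Plane) (i : Fin 2), (midpoint ℝ p q) i = (p i + q i) / 2 := by
    intro p q i
    simp [midpoint_eq_smul_add]
    ring
  refine ⟨fun p => ((p 0 - a 0) * (b 0 - a 0) + (p 1 - a 1) * (b 1 - a 1)) / dist a b,
    fun p => ((p 1 - a 1) * (b 0 - a 0) - (p 0 - a 0) * (b 1 - a 1)) / dist a b,
    ?_, by simp, by simp, ?_, ?_, ?_⟩
  · intro p q
    rw [dist_sq_eq p q]
    field_simp
    rw [hL2]
    ring
  · field_simp
    rw [hL2]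
    ring
  · field_simp
    ring
  · intro p q
    simp only [hm]
    constructor <;> ring

theorem IsGromov.isNet {η : ℝ} (hη : 0 < η) {S : Set Plane} (h : IsGromov η S) : IsNet η S := by
  intro p
  by_contra! hp
  have hsep : IsEtaSeparated η (insert p S) := by
    refine Set.pairwise_insert.2 ⟨h.1, fun s hs _ => ⟨hp s hs, ?_⟩⟩
    rw [dist_comm]
    exact hp s hs
  have hmem : p ∈ S := h.2 hsep (Set.subset_insert _ _) (Set.mem_insert _ _)
  have := hp p hmem
  rw [dist_self] at this
  linarith

/-- The bound depends only on the ratio of the radius to the separation: each cell of the square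
grid of mesh `η / 2` holds at most one point. -/
theorem exists_card_le_of_separated (K : ℕ) :
    ∃ M : ℕ, ∀ (η : ℝ), 0 < η → ∀ (S : Set Plane), IsEtaSeparated η S → ∀ (p : Plane)
      (F : Finset Plane), (F : Set Plane) ⊆ S ∩ Metric.closedBall p (K * η) → F.card ≤ M := by
  refine ⟨(Fintype.piFinset fun _ : Fin 2 => Finset.Icc (-(2 * K + 1) : ℤ) (2 * K + 1)).card, ?_⟩
  intro η hη S hS p F hF
  refine Finset.card_le_card_of_injOn (fun x i => ⌊2 * (x i - p i) / η⌋) ?_ ?_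
  · intro x hx
    have hx' := (hF hx).2
    rw [Metric.mem_closedBall] at hx'
    have hsq := dist_sq_eq x p
    have h0 : 0 ≤ dist x p := dist_nonneg
    have hK : (0 : ℝ) ≤ K * η := by positivity
    have key : ∀ i : Fin 2, |x i - p i| ≤ K * η := by
      intro i
      refine abs_le_of_sq_le_sq ?_ hK
      have : dist x p ^ 2 ≤ (K * η) ^ 2 := by gcongr
      fin_cases i
      · simp only [Fin.zero_eta]; nlinarith [sq_nonneg (x 1 - p 1)]
      · simp only [Fin.mk_one]; nlinarith [sq_nonneg (x 0 - p 0)]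
    simp only [Finset.mem_coe, Fintype.mem_piFinset, Finset.mem_Icc]
    intro i
    obtain ⟨h1, h2⟩ := abs_le.1 (key i)
    constructor
    · rw [Int.le_floor]
      push_cast
      rw [le_div_iff₀ hη]
      linarith
    · have : ⌊2 * (x i - p i) / η⌋ ≤ ((2 * K : ℤ) : ℝ) := by
        refine (Int.floor_le _).trans ?_
        push_cast
        rw [div_le_iff₀ hη]
        linarith
      have : ⌊2 * (x i - p i) / η⌋ ≤ (2 * K : ℤ) := by exact_mod_cast this
      linarith
  · intro x hx y hy hxy
    by_contra hne
    have hd := hS (hF hx).1 (hF hy).1 hne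
    have key : ∀ i : Fin 2, |x i - y i| < η / 2 := by
      intro i
      have h := Int.abs_sub_lt_one_of_floor_eq_floor (congrFun hxy i)
      have e : 2 * (x i - p i) / η - 2 * (y i - p i) / η = (x i - y i) * (2 / η) := by ring
      rw [e, abs_mul, abs_of_pos (by positivity : 0 < 2 / η), mul_div_assoc', div_lt_one hη] at h
      linarith
    have hsq := dist_sq_eq x y
    have h0 : (x 0 - y 0) ^ 2 < (η / 2) ^ 2 :=
      sq_lt_sq' (by linarith [abs_lt.1 (key 0)]) (abs_lt.1 (key 0)).2
    have h1 : (x 1 - y 1) ^ 2 < (η / 2) ^ 2 :=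
      sq_lt_sq' (by linarith [abs_lt.1 (key 1)]) (abs_lt.1 (key 1)).2
    nlinarith

theorem IsEtaSeparated.finite_inter_closedBall {σ : ℝ} (hσ : 0 < σ) {S : Set Plane}
    (h : IsEtaSeparated σ S) (p : Plane) (R : ℝ) : (S ∩ Metric.closedBall p R).Finite := by
  obtain ⟨K, hK⟩ := exists_nat_ge (R / σ)
  rw [div_le_iff₀ hσ] at hK
  obtain ⟨M, hM⟩ := exists_card_le_of_separated K
  by_contra hinf
  obtain ⟨F, hF, hcard⟩ := Set.Infinite.exists_subset_card_eq hinf (M + 1)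
  have := hM σ hσ S h p F
    (hF.trans (Set.inter_subset_inter_right _ (Metric.closedBall_subset_closedBall hK)))
  omega

theorem IsEtaSeparated.countable {σ : ℝ} (hσ : 0 < σ) {S : Set Plane}
    (h : IsEtaSeparated σ S) : S.Countable := by
  have : S = ⋃ n : ℕ, S ∩ Metric.closedBall 0 n := by
    rw [← Set.inter_iUnion, Metric.iUnion_closedBall_nat, Set.inter_univ]
  rw [this]
  exact Set.countable_iUnion fun n => (h.finite_inter_closedBall hσ 0 n).countable

/-- The finitely many points of `S` in a large ball about `p` already have `p` in their convex
hull: a line separating `p` from them would leave a point of the ball too far from `S`. -/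
theorem IsNet.convexHull_eq_univ {ρ σ : ℝ} (hσ : 0 < σ) {S : Set Plane}
    (hsep : IsEtaSeparated σ S) (h : IsNet ρ S) : convexHull ℝ S = Set.univ := by
  refine Set.eq_univ_of_forall fun p => ?_
  have hρ : 0 < ρ := by
    obtain ⟨s, _, hs⟩ := h p
    exact dist_nonneg.trans_lt hs
  set F := S ∩ Metric.closedBall p (3 * ρ)
  have hF : F.Finite := hsep.finite_inter_closedBall hσ p _
  refine convexHull_mono (Set.inter_subset_left : F ⊆ S) ?_
  by_contra hp
  obtain ⟨f, u, hpu, hu⟩ := geometric_hahn_banach_point_closed (convex_convexHull ℝ F)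
    (hF.isClosed_convexHull ℝ) hp
  set v := (InnerProductSpace.toDual ℝ Plane).symm f
  have hfv : ∀ x, f x = inner ℝ v x := fun x => by simp [v]
  by_cases hv : v = 0
  · obtain ⟨s, hs, hsp⟩ := h p
    have hsF : s ∈ F := ⟨hs, by rw [Metric.mem_closedBall, dist_comm]; linarith⟩
    have := hu s (subset_convexHull ℝ _ hsF)
    simp [hfv, hv] at this hpu
    linarith
  have hvn : 0 < ‖v‖ := norm_pos_iff.2 hv
  -- The point at distance `ρ` from `p` in the direction opposite to `v`.
  set y := p - (ρ / ‖v‖) • v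
  obtain ⟨s, hs, hsy⟩ := h y
  have hyp : dist y p = ρ := by
    simp only [y, dist_eq_norm]
    rw [sub_sub_cancel_left, norm_neg, norm_smul, Real.norm_eq_abs,
      abs_of_pos (by positivity)]
    field_simp
  have hsF : s ∈ F := ⟨hs, by
    rw [Metric.mem_closedBall]
    have := dist_triangle s y p
    rw [dist_comm s y] at this
    linarith⟩
  have h1 := hu s (subset_convexHull ℝ _ hsF)
  have h2 : f s = f p - ρ * ‖v‖ + inner ℝ v (s - y) := by
    rw [hfv, hfv, inner_sub_right v s y]
    simp only [y, inner_sub_right, inner_smul_right, real_inner_self_eq_norm_sq]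
    field_simp
    ring
  have h3 : inner ℝ v (s - y) ≤ ‖v‖ * ‖s - y‖ := real_inner_le_norm _ _
  rw [← dist_eq_norm, dist_comm] at h3
  nlinarith

/-! ### The triangles of a Delaunay triangulation -/

theorem mem_vertices_of_mem_face {T : Complex2} {t : Finset Plane} (ht : t ∈ T.faces) {v : Plane}
    (hv : v ∈ t) : v ∈ T.vertices :=
  T.down_closed ht (Finset.singleton_subset_iff.2 hv) (Finset.singleton_nonempty v)

theorem hasEdge_of_mem_face {T : Complex2} {t : Finset Plane} (ht : t ∈ T.faces) {a b : Plane}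
    (hab : a ≠ b) (ha : a ∈ t) (hb : b ∈ t) : HasEdge T a b :=
  ⟨hab, {a, b}, T.down_closed ht (by simp [Finset.insert_subset_iff, ha, hb]) (by simp), by simp⟩

theorem card_le_three_of_mem_faces {T : Complex2} {t : Finset Plane} (ht : t ∈ T.faces) :
    t.card ≤ 3 := by
  have h := (T.indep ht).card_le_finrank_succ
  have h2 : Module.finrank ℝ (vectorSpan ℝ (Set.range ((↑) : t → Plane))) ≤ 2 :=
    (Submodule.finrank_le _).trans (by simp)
  simp only [Fintype.card_coe] at h
  omega

theorem exists_circumcenter {T : Complex2} {t : Finset Plane} (ht : t ∈ T.faces) :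
    ∃ (c : Plane) (r : ℝ), ∀ v ∈ t, dist v c = r := by
  have : Nonempty t := (T.nonempty_of_mem_faces ht).to_subtype
  obtain ⟨cs, ⟨_, hcs⟩, _⟩ := (T.indep ht).existsUnique_dist_eq
  exact ⟨cs.center, cs.radius, fun v hv => hcs ⟨⟨v, hv⟩, rfl⟩⟩

theorem IsDelaunay.radius_lt {ρ : ℝ} {T : Complex2} {S : Set Plane} (h : IsDelaunay T S)
    (hS : IsNet ρ S) {t : Finset Plane} (ht : t ∈ T.faces) (h3 : t.card = 3) {c : Plane} {r : ℝ}
    (hc : ∀ v ∈ t, dist v c = r) : r < ρ := by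
  obtain ⟨s, hs, hsc⟩ := hS c
  rw [dist_comm] at hsc
  exact (not_lt.1 (h.2 t ht h3 c r hc s hs)).trans_lt hsc

theorem convexHull_subset_closedBall {t : Finset Plane} {c : Plane} {r : ℝ}
    (hc : ∀ v ∈ t, dist v c = r) : convexHull ℝ (t : Set Plane) ⊆ Metric.closedBall c r :=
  convexHull_min (fun v hv => (hc v hv).le) (convex_closedBall c r)

/-- The triangles of a complex. -/
def triangles (T : Complex2) : Set (Finset Plane) :=
  {t | t ∈ T.faces ∧ t.card = 3}

/-- The triangles of a Delaunay triangulation have bounded size, so those that meet a small ball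
have their vertices in a finite set. -/
theorem IsDelaunay.locallyFinite {ρ σ : ℝ} (hσ : 0 < σ) {T : Complex2} {S : Set Plane}
    (h : IsDelaunay T S) (hsep : IsEtaSeparated σ S) (hS : IsNet ρ S) :
    LocallyFinite fun t : triangles T => convexHull ℝ ((t : Finset Plane) : Set Plane) := by
  intro x
  refine ⟨Metric.ball x 1, Metric.ball_mem_nhds x one_pos, ?_⟩
  have hfin := hsep.finite_inter_closedBall hσ x (1 + 2 * ρ)
  have hpow : {t : triangles T | (t : Finset Plane) ∈ hfin.toFinset.powerset}.Finite :=
    (Finset.finite_toSet hfin.toFinset.powerset).preimage Subtype.val_injective.injOn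
  refine hpow.subset ?_
  rintro ⟨t, ht, h3⟩ ⟨y, hy, hyx⟩
  obtain ⟨c, r, hc⟩ := exists_circumcenter ht
  have hr := h.radius_lt hS ht h3 hc
  have hyc := convexHull_subset_closedBall hc hy
  rw [Metric.mem_closedBall] at hyc
  rw [Metric.mem_ball] at hyx
  simp only [Set.mem_ofPred_eq, Finset.mem_powerset]
  intro v hv
  rw [Set.Finite.mem_toFinset]
  refine ⟨h.1.1 ▸ mem_vertices_of_mem_face ht hv, ?_⟩
  rw [Metric.mem_closedBall]
  have h1 := dist_triangle v c y
  have h2 := dist_triangle v y x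
  rw [hc v hv, dist_comm c y] at h1
  linarith

theorem volume_convexHull_eq_zero {t : Finset Plane} (ht : t.card ≤ 2) :
    MeasureTheory.volume (convexHull ℝ (t : Set Plane)) = 0 := by
  refine MeasureTheory.measure_mono_null (convexHull_subset_affineSpan (𝕜 := ℝ) (t : Set Plane)) ?_
  refine MeasureTheory.Measure.addHaar_affineSubspace _ _ fun htop => ?_
  rcases t.eq_empty_or_nonempty with rfl | hne
  · simp at htop
  have hpos := hne.card_pos
  have h1 := finrank_vectorSpan_image_finset_le ℝ (id : Plane → Plane) t
    (n := t.card - 1) (by omega)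
  rw [Finset.coe_image, Set.image_id, ← direction_affineSpan, htop,
    AffineSubspace.direction_top, finrank_top, finrank_euclideanSpace_fin] at h1
  omega

/-- The remaining faces form a null set, and the union of the triangles is closed. -/
theorem IsDelaunay.iUnion_triangles {ρ σ : ℝ} (hσ : 0 < σ) {T : Complex2} {S : Set Plane}
    (h : IsDelaunay T S) (hsep : IsEtaSeparated σ S) (hS : IsNet ρ S) :
    ⋃ t : triangles T, convexHull ℝ ((t : Finset Plane) : Set Plane) = Set.univ := by
  set U := ⋃ t : triangles T, convexHull ℝ ((t : Finset Plane) : Set Plane) with hU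
  have hclosed : IsClosed U := (h.locallyFinite hσ hsep hS).isClosed_iUnion fun t =>
    (Finset.finite_toSet (t : Finset Plane)).isClosed_convexHull ℝ
  have hcount : T.faces.Countable := by
    have : T.faces ⊆ {t : Finset Plane | (t : Set Plane) ⊆ S} := fun t ht v hv =>
      h.1.1 ▸ mem_vertices_of_mem_face ht hv
    have hcount := Set.Countable.preimage (f := ((↑) : Finset Plane → Set Plane))
      (Set.countable_ofPred_finite_subset (hsep.countable hσ)) Finset.coe_injective
    refine hcount.mono fun t ht => ?_
    exact ⟨t.finite_toSet, this ht⟩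
  have hnull : MeasureTheory.volume (⋃ t ∈ {t ∈ T.faces | t.card ≤ 2},
      convexHull ℝ (t : Set Plane)) = 0 :=
    (MeasureTheory.measure_biUnion_null_iff (hcount.mono (Set.sep_subset _ _))).2
      fun t ht => volume_convexHull_eq_zero ht.2
  have hsub : Uᶜ ⊆ ⋃ t ∈ {t ∈ T.faces | t.card ≤ 2}, convexHull ℝ (t : Set Plane) := by
    intro x hx
    have hxs : x ∈ T.space := by
      rw [h.1.2, hS.convexHull_eq_univ hσ hsep]
      trivial
    obtain ⟨t, ht, hxt⟩ := T.mem_space_iff.1 hxs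
    refine Set.mem_biUnion ⟨ht, ?_⟩ hxt
    by_contra hcard
    have h3 : t.card = 3 := by
      have := card_le_three_of_mem_faces ht
      omega
    exact hx (Set.mem_iUnion.2 ⟨⟨t, ht, h3⟩, hxt⟩)
  have hdense : Uᶜ = ∅ :=
    hclosed.isOpen_compl.eq_empty_of_measure_zero (MeasureTheory.measure_mono_null hsub hnull)
  exact Set.compl_empty_iff.1 hdense

/-- The difference of the powers of a point with respect to two circles is an affine function of
the point.  Taking for the two circles the given one and the circumcircle of a triangle covering the
midpoint of `ab`, this function is nonnegative at the vertices of the triangle and nonpositive at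
`a` and `b`, so the midpoint is a convex combination of the vertices where the function vanishes,
and these are among `a`, `b`. -/
theorem IsDelaunay.hasEdge_of_empty_disk {ρ σ : ℝ} (hσ : 0 < σ) {T : Complex2} {S : Set Plane}
    (h : IsDelaunay T S) (hsep : IsEtaSeparated σ S) (hS : IsNet ρ S) {a b m : Plane}
    (ha : a ∈ S) (hb : b ∈ S) (hab : a ≠ b) (hm : dist a m = dist b m)
    (hempty : ∀ p ∈ S, p ≠ a → p ≠ b → dist a m < dist p m) : HasEdge T a b := by
  have hq : midpoint ℝ a b ∈ ⋃ t : triangles T, convexHull ℝ ((t : Finset Plane) : Set Plane) := by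
    rw [h.iUnion_triangles hσ hsep hS]
    trivial
  obtain ⟨⟨t, ht, h3⟩, hq⟩ := Set.mem_iUnion.1 hq
  obtain ⟨c, r, hc⟩ := exists_circumcenter ht
  have hr : 0 ≤ r := by
    obtain ⟨v, hv⟩ := T.nonempty_of_mem_faces ht
    exact hc v hv ▸ dist_nonneg
  have hmem : ∀ v ∈ t, v ∈ S := fun v hv => h.1.1 ▸ mem_vertices_of_mem_face ht hv
  obtain ⟨w, hw0, hw1, hwq⟩ := Finset.mem_convexHull'.1 hq
  set G : Plane → ℝ := fun p => (dist p m ^ 2 - dist a m ^ 2) - (dist p c ^ 2 - r ^ 2) with hG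
  have hGaff : ∀ p, G p = 2 * (p 0 * (c 0 - m 0) + p 1 * (c 1 - m 1)) +
      (m 0 ^ 2 + m 1 ^ 2 - dist a m ^ 2 - c 0 ^ 2 - c 1 ^ 2 + r ^ 2) := by
    intro p
    simp only [hG, dist_sq_eq p m, dist_sq_eq p c]
    ring
  have hGa : G a ≤ 0 := by
    have h1 := not_lt.1 (h.2 t ht h3 c r hc a ha)
    simp only [hG]
    nlinarith
  have hGb : G b ≤ 0 := by
    have h1 := not_lt.1 (h.2 t ht h3 c r hc b hb)
    simp only [hG, hm]
    nlinarith
  have hGt : ∀ v ∈ t, 0 ≤ G v ∧ (G v = 0 → v = a ∨ v = b) := by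
    intro v hv
    have e : G v = dist v m ^ 2 - dist a m ^ 2 := by simp [hG, hc v hv]
    have h0 : 0 ≤ dist a m := dist_nonneg
    by_cases hva : v = a
    · rw [e, hva]
      simp
    by_cases hvb : v = b
    · rw [e, hvb, hm]
      simp
    have := hempty v (hmem v hv) hva hvb
    have hpos : 0 < G v := by rw [e]; nlinarith
    exact ⟨hpos.le, fun h => absurd h hpos.ne'⟩
  have hq_coord : ∀ i : Fin 2, ∑ v ∈ t, w v * v i = (a i + b i) / 2 := by
    intro i
    have := congrArg (fun x : Plane => x i) hwq
    simp only [midpoint_eq_smul_add] at this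
    simp at this
    linarith
  have hsum : ∑ v ∈ t, w v * G v = (G a + G b) / 2 := by
    have e : ∀ v ∈ t, w v * G v = 2 * (c 0 - m 0) * (w v * v 0) + 2 * (c 1 - m 1) * (w v * v 1) +
        (m 0 ^ 2 + m 1 ^ 2 - dist a m ^ 2 - c 0 ^ 2 - c 1 ^ 2 + r ^ 2) * w v := by
      intro v _
      rw [hGaff]
      ring
    rw [Finset.sum_congr rfl e, Finset.sum_add_distrib, Finset.sum_add_distrib, ← Finset.mul_sum,
      ← Finset.mul_sum, ← Finset.mul_sum, hq_coord, hq_coord, hw1, hGaff a, hGaff b]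
    ring
  have hnn : ∀ v ∈ t, 0 ≤ w v * G v := fun v hv => mul_nonneg (hw0 v hv) (hGt v hv).1
  have hzero : ∀ v ∈ t, w v * G v = 0 :=
    (Finset.sum_eq_zero_iff_of_nonneg hnn).1
      (le_antisymm (by rw [hsum]; linarith) (Finset.sum_nonneg hnn))
  have hsupp : ∀ v ∈ t, w v ≠ 0 → v = a ∨ v = b := fun v hv hwv =>
    (hGt v hv).2 ((mul_eq_zero.1 (hzero v hv)).resolve_left hwv)
  -- If the weights were supported at a single point `x`, the midpoint would be `x`.
  have hsingle : ∀ x, (∀ v ∈ t, w v ≠ 0 → v = x) → midpoint ℝ a b = x := by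
    intro x hx
    rw [← hwq]
    calc ∑ v ∈ t, w v • v = ∑ v ∈ t, w v • x := by
          refine Finset.sum_congr rfl fun v hv => ?_
          by_cases hwv : w v = 0
          · simp [hwv]
          · rw [hx v hv hwv]
      _ = x := by rw [← Finset.sum_smul, hw1, one_smul]
  refine hasEdge_of_mem_face ht hab ?_ ?_
  · by_contra hat
    have := hsingle b fun v hv hwv => (hsupp v hv hwv).resolve_left fun h => hat (h ▸ hv)
    exact hab (midpoint_eq_right_iff ℝ |>.1 this)
  · by_contra hbt
    have := hsingle a fun v hv hwv => (hsupp v hv hwv).resolve_right fun h => hbt (h ▸ hv)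
    exact hab (midpoint_eq_left_iff ℝ |>.1 this)

/-- The midpoint of `ab` is a limit of points where `f` is larger than at `a`. By local
finiteness such points of a single triangle accumulate there, and this triangle contains the edge
`ab`. -/
theorem IsDelaunay.exists_triangle_on_side {ρ σ : ℝ} (hσ : 0 < σ) {T : Complex2} {S : Set Plane}
    (h : IsDelaunay T S) (hsep : IsEtaSeparated σ S) (hS : IsNet ρ S) {a b : Plane}
    (hedge : HasEdge T a b) (f : Plane →ₗ[ℝ] ℝ) (hf : f ≠ 0) (hfab : f a = f b) :
    ∃ t ∈ triangles T, a ∈ t ∧ b ∈ t ∧ ∃ w ∈ t, f a < f w := by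
  obtain ⟨hab, e, he, hecoe⟩ := hedge
  set q := midpoint ℝ a b
  have hfq : f q = f a := by
    simp only [q, midpoint_eq_smul_add, map_smul, map_add, ← hfab, smul_eq_mul]
    norm_num
    ring
  set A : Set Plane := {p | f a < f p} with hA
  obtain ⟨v, hv⟩ : ∃ v, 0 < f v := by
    obtain ⟨v, hv⟩ : ∃ v, f v ≠ 0 := by
      by_contra! hcon
      exact hf (LinearMap.ext hcon)
    rcases lt_or_gt_of_ne hv with h | h
    · exact ⟨-v, by simpa using h⟩
    · exact ⟨v, h⟩
  have hqA : q ∈ closure A := by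
    have hlim : Filter.Tendsto (fun s : ℝ => q + s • v) (nhdsWithin 0 (Set.Ioi 0)) (nhds q) := by
      have hcont : Continuous fun s : ℝ => q + s • v := by fun_prop
      have := (hcont.tendsto 0).mono_left (nhdsWithin_le_nhds (s := Set.Ioi 0))
      simpa using this
    refine mem_closure_of_tendsto hlim ?_
    filter_upwards [self_mem_nhdsWithin] with s hs
    simp only [hA, Set.mem_ofPred_eq, map_add, map_smul, hfq, smul_eq_mul]
    have := mul_pos (Set.mem_Ioi.1 hs) hv
    linarith
  have hAU : A = ⋃ t : triangles T, A ∩ convexHull ℝ ((t : Finset Plane) : Set Plane) := by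
    rw [← Set.inter_iUnion, h.iUnion_triangles hσ hsep hS, Set.inter_univ]
  rw [hAU, ((h.locallyFinite hσ hsep hS).subset fun _ => Set.inter_subset_right).closure_iUnion]
    at hqA
  obtain ⟨⟨t, ht, h3⟩, hqt⟩ := Set.mem_iUnion.1 hqA
  have hqhull : q ∈ convexHull ℝ (t : Set Plane) :=
    closure_minimal Set.inter_subset_right
      ((Finset.finite_toSet t).isClosed_convexHull ℝ) hqt
  obtain ⟨p, hpA, hpt⟩ : (A ∩ convexHull ℝ (t : Set Plane)).Nonempty :=
    closure_nonempty_iff.1 ⟨q, hqt⟩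
  have hqe : q ∈ convexHull ℝ (e : Set Plane) := by
    rw [hecoe, convexHull_pair]
    exact midpoint_mem_segment a b
  have hint := T.inter_subset_convexHull he ht ⟨hqe, hqhull⟩
  rw [hecoe] at hint
  refine ⟨t, ⟨ht, h3⟩, ?_, ?_, ?_⟩
  · by_contra hat
    have hsub : ({a, b} ∩ (t : Set Plane)) ⊆ {b} := by
      rintro x ⟨rfl | rfl, hx⟩
      · exact absurd hx hat
      · rfl
    have := convexHull_mono hsub hint
    rw [convexHull_singleton] at this
    exact hab (midpoint_eq_right_iff ℝ |>.1 this)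
  · by_contra hbt
    have hsub : ({a, b} ∩ (t : Set Plane)) ⊆ {a} := by
      rintro x ⟨rfl | rfl, hx⟩
      · rfl
      · exact absurd hx hbt
    have := convexHull_mono hsub hint
    rw [convexHull_singleton] at this
    exact hab (midpoint_eq_left_iff ℝ |>.1 this)
  · by_contra! hcon
    have hconv : Convex ℝ {x | f x ≤ f a} := convex_halfSpace_le f.isLinear (f a)
    have : p ∈ {x | f x ≤ f a} := convexHull_min (fun x hx => hcon x hx) hconv hpt
    exact not_lt.2 (Set.mem_ofPred.1 this) (Set.mem_ofPred.1 hpA)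

/-- There is a triangle on each side of the edge. -/
theorem IsDelaunay.exists_two_triangles {ρ σ : ℝ} (hσ : 0 < σ) {T : Complex2} {S : Set Plane}
    (h : IsDelaunay T S) (hsep : IsEtaSeparated σ S) (hS : IsNet ρ S) {a b : Plane}
    (hedge : HasEdge T a b) :
    ∃ t ∈ triangles T, ∃ t' ∈ triangles T, t ≠ t' ∧ a ∈ t ∧ b ∈ t ∧ a ∈ t' ∧ b ∈ t' := by
  have hab := hedge.1
  set f : Plane →ₗ[ℝ] ℝ := (b 0 - a 0) • (EuclideanSpace.proj (𝕜 := ℝ) (1 : Fin 2)).toLinearMap -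
    (b 1 - a 1) • (EuclideanSpace.proj (𝕜 := ℝ) (0 : Fin 2)).toLinearMap with hf
  have hfx : ∀ x : Plane, f x = (b 0 - a 0) * x 1 - (b 1 - a 1) * x 0 := fun x => by simp [hf]
  have hf0 : f ≠ 0 := by
    intro hcon
    have h1 := congrArg (fun g : Plane →ₗ[ℝ] ℝ => g !₂[a 1 - b 1, b 0 - a 0]) hcon
    simp [hfx] at h1
    have h2 := dist_sq_eq a b
    exact hab (dist_eq_zero.1 (pow_eq_zero_iff two_ne_zero |>.1 (by rw [h2]; linarith)))
  have hfab : f a = f b := by rw [hfx, hfx]; ring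
  obtain ⟨t, ht, hat, hbt, w, hw, hfw⟩ := h.exists_triangle_on_side hσ hsep hS hedge f hf0 hfab
  obtain ⟨t', ht', hat', hbt', w', hw', hfw'⟩ :=
    h.exists_triangle_on_side hσ hsep hS hedge (-f) (neg_ne_zero.2 hf0) (by simp [hfab])
  refine ⟨t, ht, t', ht', ?_, hat, hbt, hat', hbt'⟩
  rintro rfl
  simp only [LinearMap.neg_apply, neg_lt_neg_iff] at hfw'
  have hsub : ({a, b, w, w'} : Finset Plane) ⊆ t := by
    simp [Finset.insert_subset_iff, hat, hbt, hw, hw']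
  have h1 : a ≠ w := fun e => by rw [e] at hfw; exact lt_irrefl _ hfw
  have h2 : b ≠ w := fun e => by rw [hfab, e] at hfw; exact lt_irrefl _ hfw
  have h3 : a ≠ w' := fun e => by rw [e] at hfw'; exact lt_irrefl _ hfw'
  have h4 : b ≠ w' := fun e => by rw [hfab, e] at hfw'; exact lt_irrefl _ hfw'
  have h5 : w ≠ w' := fun e => by rw [e] at hfw; exact lt_asymm hfw hfw'
  have hc := Finset.card_le_card hsub
  rw [ht.2, Finset.card_insert_of_notMem (by simp [hab, h1, h3]),
    Finset.card_insert_of_notMem (by simp [h2, h4]), Finset.card_pair h5] at hc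
  omega

/-! ### Protected edges are stable -/

/-- In coordinates with `a = (0, 0)` and `b = (L, 0)`, the points `(L / 2, y₁)` and `(L / 2, y₂)`
are the centers of two circles through `a` and `b` that do not enclose the point `(s, h)`.  If the
centers are far apart, the power of `(s, h)` with respect to the circle centered at their midpoint
is bounded below: far from the line `ab` because it is at least `|h| * |y₁ - y₂|`, and near this
line because `(s, h)` is not near the segment `ab`. -/
theorem power_lower_bound {η ε L s h y₁ y₂ : ℝ} (hη : 0 < η) (hε : 0 ≤ ε) (hε1 : ε ≤ 1)
    (ha : η ^ 2 ≤ s ^ 2 + h ^ 2) (hb : η ^ 2 ≤ (s - L) ^ 2 + h ^ 2)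
    (hr₁ : y₁ ^ 2 ≤ η ^ 2) (hr₂ : y₂ ^ 2 ≤ η ^ 2)
    (hp₁ : (L / 2) ^ 2 + y₁ ^ 2 ≤ (s - L / 2) ^ 2 + (h - y₁) ^ 2)
    (hp₂ : (L / 2) ^ 2 + y₂ ^ 2 ≤ (s - L / 2) ^ 2 + (h - y₂) ^ 2)
    (hy : (ε * η) ^ 2 ≤ (y₁ - y₂) ^ 2) :
    (L / 2) ^ 2 + ((y₁ + y₂) / 2) ^ 2 + ε / 10 * η ^ 2 ≤
      (s - L / 2) ^ 2 + (h - (y₁ + y₂) / 2) ^ 2 := by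
  have hy' : ε * η ≤ |y₁ - y₂| := by
    have := sq_le_sq.1 hy
    rwa [abs_of_nonneg (by positivity)] at this
  have hy1 : |y₁| ≤ η := abs_le_of_sq_le_sq hr₁ hη.le
  have hy2 : |y₂| ≤ η := abs_le_of_sq_le_sq hr₂ hη.le
  have hm : |(y₁ + y₂) / 2| ≤ η := by
    rw [abs_le] at *
    constructor <;> linarith
  set y := (y₁ + y₂) / 2 with hydef
  have hhy₀ : 2 * (h * y) = h * y₁ + h * y₂ := by
    rw [hydef]
    ring
  have hP₁ : 0 ≤ s * (s - L) + h ^ 2 - 2 * (h * y₁) := by linarith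
  have hP₂ : 0 ≤ s * (s - L) + h ^ 2 - 2 * (h * y₂) := by linarith
  suffices hsuff : ε / 10 * η ^ 2 ≤ s * (s - L) + h ^ 2 - 2 * (h * y) by linarith
  rcases le_or_gt (η / 10) |h| with hh | hh
  · have h1 : |h * (y₁ - y₂)| ≤ s * (s - L) + h ^ 2 - 2 * (h * y) := by
      rw [abs_le]
      constructor <;> linarith
    rw [abs_mul] at h1
    have h2 : η / 10 * (ε * η) ≤ |h| * |y₁ - y₂| := by gcongr
    linarith
  · have hhy : |h * y| ≤ η / 10 * η := by
      rw [abs_mul]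
      gcongr
    have hh2 : h ^ 2 ≤ (η / 10) ^ 2 := by
      rw [← sq_abs h]
      gcongr
    have hhy' := abs_le.1 hhy
    have hη2 : 0 < η ^ 2 := by positivity
    have hεη : ε * η ^ 2 ≤ 1 * η ^ 2 := by gcongr
    have a1 : (9 / 10) * η ≤ |s| := by
      have := sq_le_sq.1 (show (9 / 10 * η) ^ 2 ≤ s ^ 2 by linarith)
      rwa [abs_of_nonneg (by positivity)] at this
    have a2 : (9 / 10) * η ≤ |s - L| := by
      have := sq_le_sq.1 (show (9 / 10 * η) ^ 2 ≤ (s - L) ^ 2 by linarith)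
      rwa [abs_of_nonneg (by positivity)] at this
    have a3 : (81 / 100) * η ^ 2 ≤ |s * (s - L)| := by
      rw [abs_mul]
      calc (81 / 100) * η ^ 2 = (9 / 10) * η * ((9 / 10) * η) := by ring
        _ ≤ _ := by gcongr
    have hh0 := sq_nonneg h
    -- A negative value of `s * (s - L)` would put `(s, h)` inside both circles.
    rcases le_abs.1 a3 with h1 | h1 <;> linarith

/-- The circle centered at the midpoint of `c₁` and `c₂` passes through `a` and `b` and stays away
from all other points of `S`. -/
theorem exists_protecting_disk {η ε : ℝ} (hη : 0 < η) (hε : 0 < ε) (hε1 : ε ≤ 1)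
    {S : Set Plane} (hsep : IsEtaSeparated η S) {a b c₁ c₂ : Plane} (ha : a ∈ S) (hb : b ∈ S)
    (hab : a ≠ b) (h₁ : dist a c₁ = dist b c₁) (h₂ : dist a c₂ = dist b c₂)
    (hr₁ : dist a c₁ ≤ η) (hr₂ : dist a c₂ ≤ η)
    (hp₁ : ∀ p ∈ S, dist a c₁ ≤ dist p c₁) (hp₂ : ∀ p ∈ S, dist a c₂ ≤ dist p c₂)
    (hc : ε * η ≤ dist c₁ c₂) :
    ∃ m, dist a m = dist b m ∧ dist a m ≤ η ∧
      ∀ p ∈ S, p ≠ a → p ≠ b → dist a m + ε / 30 * η ≤ dist p m := by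
  obtain ⟨X, Y, hd, hXa, hYa, hXb, hYb, hmid⟩ := exists_frame hab
  have hL : η ≤ dist a b := hsep ha hb hab
  set L := dist a b with hLdef
  have hL0 : L ≠ 0 := by linarith
  -- The center of a circle through `a` and `b` has first coordinate `L / 2`.
  have hcen : ∀ c, dist a c = dist b c → X c = L / 2 := by
    intro c hac
    have e1 := hd a c
    have e2 := hd b c
    rw [hac, e2, hXa, hYa, hXb, hYb] at e1
    have : L * (L - 2 * X c) = 0 := by linarith
    have := (mul_eq_zero.1 this).resolve_left hL0
    linarith
  have hX₁ := hcen c₁ h₁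
  have hX₂ := hcen c₂ h₂
  set m := midpoint ℝ c₁ c₂
  have hXm : X m = L / 2 := by rw [(hmid c₁ c₂).1, hX₁, hX₂]; ring
  have hYm : Y m = (Y c₁ + Y c₂) / 2 := (hmid c₁ c₂).2
  have hdac : ∀ c, X c = L / 2 → dist a c ^ 2 = (L / 2) ^ 2 + Y c ^ 2 := by
    intro c hXc
    rw [hd a c, hXa, hYa, hXc]
    ring
  have hsq : ∀ {x y : ℝ}, 0 ≤ x → x ≤ y → x ^ 2 ≤ y ^ 2 := fun hx hxy => by gcongr
  have hR₁ := hsq dist_nonneg hr₁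
  have hR₂ := hsq dist_nonneg hr₂
  rw [hdac c₁ hX₁] at hR₁
  rw [hdac c₂ hX₂] at hR₂
  have hrm : dist a m ≤ η := by
    refine abs_le_of_sq_le_sq' ?_ hη.le |>.2
    rw [hdac m hXm, hYm]
    nlinarith [sq_nonneg (Y c₁ - Y c₂)]
  refine ⟨m, ?_, hrm, ?_⟩
  · refine (sq_eq_sq₀ dist_nonneg dist_nonneg).1 ?_
    rw [hd a m, hd b m, hXa, hYa, hXb, hYb, hXm]
    ring
  · intro p hp hpa hpb
    have e₁ := hsq dist_nonneg (hp₁ p hp)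
    have e₂ := hsq dist_nonneg (hp₂ p hp)
    have ea := hsq hη.le (hsep hp ha hpa)
    have eb := hsq hη.le (hsep hp hb hpb)
    have ec := hsq (by positivity) hc
    rw [hdac c₁ hX₁, hd p c₁, hX₁] at e₁
    rw [hdac c₂ hX₂, hd p c₂, hX₂] at e₂
    rw [hd p a, hXa, hYa, sub_zero, sub_zero] at ea
    rw [hd p b, hXb, hYb, sub_zero] at eb
    rw [hd c₁ c₂, hX₁, hX₂, sub_self] at ec
    have key := power_lower_bound hη hε.le hε1 ea eb
      (by nlinarith [sq_nonneg (L / 2)]) (by nlinarith [sq_nonneg (L / 2)]) e₁ e₂ (by linarith)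
    rw [← hYm, ← hdac m hXm, ← hXm, ← hd p m] at key
    refine abs_le_of_sq_le_sq' ?_ dist_nonneg |>.2
    have h0 : 0 ≤ dist a m := dist_nonneg
    have h1 : ε * η * dist a m ≤ ε * η * η := by gcongr
    have h2 : ε * (ε * η ^ 2) ≤ 1 * (ε * η ^ 2) := by gcongr
    nlinarith

/-- Projecting `m` to the perpendicular bisector of `ab` gives the point `m'`. -/
theorem exists_equidistant_near {a b : Plane} (hab : a ≠ b) (m : Plane) :
    ∃ m', dist a m' = dist b m' ∧
      2 * (dist m m' * dist a b) = |dist a m ^ 2 - dist b m ^ 2| := by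
  set t := (dist a m ^ 2 - dist b m ^ 2) / (2 * dist a b ^ 2) with ht
  have hL : dist a b ≠ 0 := dist_ne_zero.2 hab
  have htL : 2 * dist a b ^ 2 * t = dist a m ^ 2 - dist b m ^ 2 := by
    rw [ht]
    field_simp
  refine ⟨m - t • (b - a), ?_, ?_⟩
  · refine (sq_eq_sq₀ dist_nonneg dist_nonneg).1 ?_
    rw [dist_sq_eq a b, dist_sq_eq a m, dist_sq_eq b m] at htL
    rw [dist_sq_eq, dist_sq_eq]
    simp
    linarith
  · rw [dist_eq_norm m, sub_sub_cancel, norm_smul, ← dist_eq_norm, dist_comm b a, ← htL, abs_mul,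
      abs_of_nonneg (by positivity : 0 ≤ 2 * dist a b ^ 2), Real.norm_eq_abs]
    ring

/-- Perturbing the points by less than `ξ * η` moves the center of the protecting disk by at most
`8 * ξ * η`. The distances of the points from the center thus change by at most `9 * ξ * η`, and the
disk still contains no further points. -/
theorem isStable_of_protecting_disk {η κ ξ : ℝ} (hη : 0 < η) (hξ : 0 < ξ) (hξ1 : ξ ≤ 1 / 4)
    (hκ : 18 * ξ < κ) {S : Set Plane} (hsep : IsEtaSeparated η S) (hnet : IsNet η S)
    {a b m : Plane} (ha : a ∈ S) (hb : b ∈ S) (hab : a ≠ b) (hm : dist a m = dist b m)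
    (hr : dist a m ≤ η) (hp : ∀ p ∈ S, p ≠ a → p ≠ b → dist a m + κ * η ≤ dist p m) :
    IsStable (ξ * η) S a b := by
  refine ⟨ha, hb, fun ι _ hι => ⟨⟨_, rfl⟩, ⟨_, rfl⟩, fun T hT => ?_⟩⟩
  have hξη : 0 < ξ * η := by positivity
  have hξη1 : ξ * η ≤ η / 4 := by nlinarith
  have hdist : ∀ x y : S, x ≠ y → η / 2 ≤ dist (ι x) (ι y) := by
    intro x y hxy
    have h1 := hsep x.2 y.2 fun h => hxy (Subtype.ext h)
    have h2 := dist_triangle4 (x : Plane) (ι x) (ι y) y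
    have hx := hι x
    have hy := hι y
    rw [dist_comm] at hx
    linarith
  have hsep' : IsEtaSeparated (η / 2) (Set.range ι) := by
    rintro _ ⟨x, rfl⟩ _ ⟨y, rfl⟩ hxy
    exact hdist x y fun h => hxy (h ▸ rfl)
  have hnet' : IsNet (2 * η) (Set.range ι) := by
    intro p
    obtain ⟨s, hs, hps⟩ := hnet p
    refine ⟨ι ⟨s, hs⟩, ⟨_, rfl⟩, ?_⟩
    have h1 := dist_triangle p s (ι ⟨s, hs⟩)
    have h2 := hι ⟨s, hs⟩
    rw [dist_comm] at h2
    simp only at h2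
    linarith
  set a' := ι ⟨a, ha⟩
  set b' := ι ⟨b, hb⟩
  have hab' : η / 2 ≤ dist a' b' := hdist _ _ fun h => hab (congrArg Subtype.val h)
  have hne : a' ≠ b' := dist_pos.1 (by linarith)
  have haa : dist a' a < ξ * η := hι ⟨a, ha⟩
  have hbb : dist b' b < ξ * η := hι ⟨b, hb⟩
  obtain ⟨m', hm', hmm⟩ := exists_equidistant_near hne m
  have hmm' : dist m m' ≤ 8 * (ξ * η) := by
    have t1 := dist_triangle a' a m
    have t2 := dist_triangle b' b m
    have t3 := dist_triangle a a' m
    have t4 := dist_triangle b b' m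
    rw [dist_comm a a'] at t3
    rw [dist_comm b b'] at t4
    have hA : |dist a' m - dist b' m| ≤ 2 * (ξ * η) := by
      rw [abs_le]
      constructor <;> linarith
    have hB : dist a' m + dist b' m ≤ 4 * η := by linarith
    have hB0 : 0 ≤ dist a' m + dist b' m := by positivity
    have e : dist a' m ^ 2 - dist b' m ^ 2 =
        (dist a' m - dist b' m) * (dist a' m + dist b' m) := by ring
    rw [e, abs_mul, abs_of_nonneg hB0] at hmm
    have h1 : |dist a' m - dist b' m| * (dist a' m + dist b' m) ≤ 2 * (ξ * η) * (4 * η) := by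
      gcongr
    have h2 : dist m m' * (η / 2) ≤ dist m m' * dist a' b' := by gcongr
    refine le_of_mul_le_mul_right ?_ hη
    linarith
  refine hT.hasEdge_of_empty_disk (half_pos hη) hsep' hnet' ⟨_, rfl⟩ ⟨_, rfl⟩ hne hm' ?_
  rintro _ ⟨p, rfl⟩ hpa hpb
  have hp' := hp p p.2 (fun h => hpa (congrArg ι (Subtype.ext h)))
    (fun h => hpb (congrArg ι (Subtype.ext h)))
  have t1 := dist_triangle4 a' a m m'
  have t2 := dist_triangle4 (p : Plane) (ι p) m' m
  have t3 := hι p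
  rw [dist_comm m' m, dist_comm (p : Plane) (ι p)] at t2
  nlinarith

/-! ### Chains of triangles -/

/-- If at most `N` reachable points lie within `N * δ` of the start, then the sets of points
reachable in at most `k` steps cannot grow strictly for `k = 0, …, N`, so every
reachable point is reachable in at most `N` steps. -/
theorem dist_le_of_reflTransGen {α : Type*} {r : α → α → Prop} {c : α → Plane} {δ : ℝ} {N : ℕ}
    {x₀ : α} (hδ : 0 ≤ δ) (hr : ∀ x y, r x y → dist (c x) (c y) ≤ δ)
    (hN : ∀ F : Finset α,
      (∀ x ∈ F, Relation.ReflTransGen r x₀ x ∧ dist (c x) (c x₀) ≤ N * δ) → F.card ≤ N)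
    {x : α} (hx : Relation.ReflTransGen r x₀ x) : dist (c x) (c x₀) ≤ N * δ := by
  classical
  -- `A k` consists of the points reachable in at most `k` steps.
  obtain ⟨A, hA0, hAs⟩ : ∃ A : ℕ → Set α, A 0 = {x₀} ∧
      ∀ k, A (k + 1) = A k ∪ {y | ∃ x ∈ A k, r x y} :=
    ⟨fun k => Nat.rec {x₀} (fun _ B => B ∪ {y | ∃ x ∈ B, r x y}) k, rfl, fun _ => rfl⟩
  have hAmono : Monotone A := monotone_nat_of_le_succ fun k => by
    rw [hAs]
    exact Set.subset_union_left
  have hA : ∀ k, ∀ y ∈ A k, Relation.ReflTransGen r x₀ y ∧ dist (c y) (c x₀) ≤ k * δ := by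
    intro k
    induction k with
    | zero =>
      intro y hy
      obtain rfl : y = x₀ := by simpa [hA0] using hy
      exact ⟨Relation.ReflTransGen.refl, by simp⟩
    | succ k ih =>
      intro y hy
      rw [hAs] at hy
      push_cast
      rcases hy with hy | ⟨z, hz, hzy⟩
      · exact ⟨(ih y hy).1, (ih y hy).2.trans (by linarith)⟩
      · refine ⟨(ih z hz).1.tail hzy, ?_⟩
        have h1 := dist_triangle (c y) (c z) (c x₀)
        have h2 := hr z y hzy
        have h3 := (ih z hz).2
        rw [dist_comm] at h2
        linarith
  have hgrow : ∀ k ≤ N, (∃ j < k, A (j + 1) ⊆ A j) ∨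
      ∃ F : Finset α, (F : Set α) ⊆ A k ∧ F.card = k + 1 := by
    intro k
    induction k with
    | zero => exact fun _ => Or.inr ⟨{x₀}, by simp [hA0], by simp⟩
    | succ k ih =>
      intro hk
      rcases ih (by omega) with ⟨j, hj, hsub⟩ | ⟨F, hF, hcard⟩
      · exact Or.inl ⟨j, by omega, hsub⟩
      · by_cases hsub : A (k + 1) ⊆ A k
        · exact Or.inl ⟨k, by omega, hsub⟩
        · obtain ⟨y, hy, hyk⟩ := Set.not_subset.1 hsub
          refine Or.inr ⟨insert y F, ?_, ?_⟩
          · rw [Finset.coe_insert, Set.insert_subset_iff]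
            exact ⟨hy, hF.trans (hAmono k.le_succ)⟩
          · rw [Finset.card_insert_of_notMem fun h => hyk (hF h), hcard]
  rcases hgrow N le_rfl with ⟨j, hj, hsub⟩ | ⟨F, hF, hcard⟩
  · have hall : x ∈ A j := by
      induction hx with
      | refl => exact hAmono (Nat.zero_le j) (by simp [hA0])
      | tail _ hyz ih => exact hsub (hAs j ▸ Or.inr ⟨_, ih, hyz⟩)
    refine (hA j x hall).2.trans ?_
    gcongr
  · have := hN F fun y hy => hA N y (hF hy)
    omega

/-- Two triangles of `T` are linked at scale `ξ` if they share an edge that is not `ξ`-stable. -/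
def IsLinked (ξ : ℝ) (T : Complex2) (t t' : Finset Plane) : Prop :=
  t ∈ triangles T ∧ t' ∈ triangles T ∧
    ∃ a b, a ≠ b ∧ a ∈ t ∧ b ∈ t ∧ a ∈ t' ∧ b ∈ t' ∧ ¬ IsStable ξ T.vertices a b

/-- If the circumcenters were further apart, the common edge would be protected by a
margin of `ε / 30 * η`, hence stable under perturbations by less than `ε / 600 * η`. -/
theorem dist_circumcenter_le_of_isLinked {η ε : ℝ} (hη : 0 < η) (hε : 0 < ε) (hε1 : ε ≤ 1)
    {S : Set Plane} (hS : IsGromov η S) {T : Complex2} (hT : IsDelaunay T S)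
    {t t' : Finset Plane} (h : IsLinked (ε / 600 * η) T t t') {c c' : Plane} {r r' : ℝ}
    (hc : ∀ v ∈ t, dist v c = r) (hc' : ∀ v ∈ t', dist v c' = r') : dist c c' ≤ ε * η := by
  obtain ⟨⟨ht, h3⟩, ⟨ht', h3'⟩, a, b, hab, hat, hbt, hat', hbt', hstable⟩ := h
  by_contra! hlt
  have hnet := hS.isNet hη
  have haS : a ∈ S := hT.1.1 ▸ mem_vertices_of_mem_face ht hat
  have hbS : b ∈ S := hT.1.1 ▸ mem_vertices_of_mem_face ht hbt
  have hr := hT.radius_lt hnet ht h3 hc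
  have hr' := hT.radius_lt hnet ht' h3' hc'
  obtain ⟨m, hm, hmη, hp⟩ := exists_protecting_disk hη hε hε1 hS.1 haS hbS hab
    (c₁ := c) (c₂ := c')
    ((hc a hat).trans (hc b hbt).symm) ((hc' a hat').trans (hc' b hbt').symm)
    ((hc a hat).trans_le hr.le) ((hc' a hat').trans_le hr'.le)
    (fun p hp => by rw [hc a hat]; exact not_lt.1 (hT.2 t ht h3 c r hc p hp))
    (fun p hp => by rw [hc' a hat']; exact not_lt.1 (hT.2 t' ht' h3' c' r' hc' p hp)) hlt.le
  refine hstable ?_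
  rw [hT.1.1]
  exact isStable_of_protecting_disk hη (by positivity) (by linarith) (by linarith) hS.1 hnet
    haS hbS hab hm hmη hp

/-- The circumcenters along a chain of linked triangles stay close to the first one, since only
boundedly many triangles have their circumcenter there. -/
theorem exists_dist_circumcenter_le :
    ∃ ξ : ℝ, 0 < ξ ∧ ∀ η : ℝ, 0 < η → ∀ (S : Set Plane), IsGromov η S → ∀ T, IsDelaunay T S →
      ∀ t₀ ∈ triangles T, ∀ t, Relation.ReflTransGen (IsLinked (ξ * η) T) t₀ t →
      ∃ (c₀ c : Plane) (r₀ r : ℝ), (∀ v ∈ t₀, dist v c₀ = r₀) ∧ (∀ v ∈ t, dist v c = r) ∧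
        dist c c₀ ≤ η / 10 := by
  classical
  obtain ⟨M, hM⟩ := exists_card_le_of_separated 2
  set N := 2 ^ M with hN
  have hN0 : (1 : ℝ) ≤ (N : ℝ) := by exact_mod_cast Nat.one_le_two_pow
  set ε : ℝ := 1 / (10 * N) with hε
  have hε0 : 0 < ε := by positivity
  have hNε : N * ε = 1 / 10 := by
    rw [hε]
    field_simp
  have hε1 : ε ≤ 1 := by nlinarith
  refine ⟨ε / 600, by positivity, ?_⟩
  intro η hη S hS T hT t₀ ht₀ t hreach
  have hnet := hS.isNet hη
  have hreach_tri : ∀ t, Relation.ReflTransGen (IsLinked (ε / 600 * η) T) t₀ t →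
      t ∈ triangles T := by
    intro t h
    rcases Relation.ReflTransGen.cases_tail h with rfl | ⟨_, _, h⟩
    · exact ht₀
    · exact h.2.1
  have hex : ∀ s : Finset Plane, ∃ z : Plane, s ∈ triangles T → ∃ ρ, ∀ v ∈ s, dist v z = ρ := by
    intro s
    by_cases hs : s ∈ triangles T
    · obtain ⟨z, ρ, h⟩ := exists_circumcenter hs.1
      exact ⟨z, fun _ => ⟨ρ, h⟩⟩
    · exact ⟨0, fun h => absurd h hs⟩
  choose z hz using hex
  have hlink : ∀ s s', IsLinked (ε / 600 * η) T s s' → dist (z s) (z s') ≤ ε * η := by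
    intro s s' h
    obtain ⟨ρ, hρ⟩ := hz s h.1
    obtain ⟨ρ', hρ'⟩ := hz s' h.2.1
    exact dist_circumcenter_le_of_isLinked hη hε0 hε1 hS hT h hρ hρ'
  have hNεη : N * (ε * η) = η / 10 := by
    rw [← mul_assoc, hNε]
    ring
  have hfin := hS.1.finite_inter_closedBall hη (z t₀) (2 * η)
  have hcard : ∀ F : Finset (Finset Plane), (∀ s ∈ F,
      Relation.ReflTransGen (IsLinked (ε / 600 * η) T) t₀ s ∧ dist (z s) (z t₀) ≤ N * (ε * η)) →
      F.card ≤ N := by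
    intro F hF
    have hsub : F ⊆ hfin.toFinset.powerset := by
      intro s hs
      obtain ⟨h1, h2⟩ := hF s hs
      have hs' := hreach_tri s h1
      obtain ⟨ρ, hρ⟩ := hz s hs'
      have hlt := hT.radius_lt hnet hs'.1 hs'.2 hρ
      refine Finset.mem_powerset.2 fun v hv => ?_
      rw [Set.Finite.mem_toFinset]
      refine ⟨hT.1.1 ▸ mem_vertices_of_mem_face hs'.1 hv, ?_⟩
      rw [Metric.mem_closedBall]
      have h3 := dist_triangle v (z s) (z t₀)
      rw [hρ v hv] at h3
      rw [hNεη] at h2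
      linarith
    refine (Finset.card_le_card hsub).trans ?_
    rw [Finset.card_powerset]
    refine Nat.pow_le_pow_right two_pos (hM η hη S hS.1 (z t₀) _ ?_)
    rw [Set.Finite.coe_toFinset, Nat.cast_ofNat]
  obtain ⟨r₀, hr₀⟩ := hz t₀ ht₀
  obtain ⟨r, hr⟩ := hz t (hreach_tri t hreach)
  refine ⟨z t₀, z t, r₀, r, hr₀, hr, ?_⟩
  rw [← hNεη]
  exact dist_le_of_reflTransGen (by positivity) hlink hcard hreach

/-- A chord of length at least `η` of a circle of radius at most `η` has its midpoint at distance
at most `√3 / 2 * η` from the center, and `√3 / 2 < 87 / 100`. -/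
theorem dist_midpoint_center_le {η : ℝ} (hη : 0 < η) {a b c : Plane} (hab : η ≤ dist a b)
    (hac : dist a c = dist b c) (hr : dist a c ≤ η) :
    dist (midpoint ℝ a b) c ≤ 87 / 100 * η := by
  obtain ⟨X, Y, hd, hXa, hYa, hXb, hYb, hmid⟩ := exists_frame (dist_pos.1 (hη.trans_le hab))
  refine abs_le_of_sq_le_sq' ?_ (by positivity) |>.2
  have h1 := hd a c
  have h2 := hd b c
  rw [← hac, h1, hXa, hYa, hXb, hYb] at h2
  rw [hXa, hYa] at h1
  rw [hd, (hmid a b).1, (hmid a b).2, hXa, hYa, hXb, hYb]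
  have h3 : dist a c ^ 2 ≤ η ^ 2 := by gcongr
  have h4 : η ^ 2 ≤ dist a b ^ 2 := by gcongr
  nlinarith

/-! ### The stable hull of a subcomplex -/

/-- The triangles of `Tmax` that are joined by a chain of linked triangles to a triangle containing
an edge of `T` that is not `ξ`-stable. -/
def addedTriangles (ξ : ℝ) (T Tmax : Complex2) : Set (Finset Plane) :=
  {t | ∃ a b, HasEdge T a b ∧ ¬ IsStable ξ Tmax.vertices a b ∧
    ∃ t₀ ∈ triangles Tmax, a ∈ t₀ ∧ b ∈ t₀ ∧ Relation.ReflTransGen (IsLinked ξ Tmax) t₀ t}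

theorem addedTriangles_subset (ξ : ℝ) (T Tmax : Complex2) :
    addedTriangles ξ T Tmax ⊆ triangles Tmax := by
  rintro t ⟨a, b, _, _, t₀, ht₀, _, _, h⟩
  rcases Relation.ReflTransGen.cases_tail h with rfl | ⟨_, _, h⟩
  · exact ht₀
  · exact h.2.1

/-- The subcomplex of `Tmax` obtained from `T` by adding the triangles of
`addedTriangles ξ T Tmax` and their faces. -/
def stableHull (ξ : ℝ) {T Tmax : Complex2} (hle : T ≤ Tmax) : Complex2 where
  faces := T.faces ∪ {s | s.Nonempty ∧ ∃ t ∈ addedTriangles ξ T Tmax, s ⊆ t}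
  isRelLowerSet_faces := by
    rintro s (hs | ⟨hs, t, ht, hst⟩)
    · exact ⟨T.nonempty_of_mem_faces hs, fun u hu hne => Or.inl (T.down_closed hs hu hne)⟩
    · exact ⟨hs, fun u hu hne => Or.inr ⟨hne, t, ht, hu.trans hst⟩⟩
  indep := by
    rintro s (hs | ⟨hs, t, ht, hst⟩)
    · exact T.indep hs
    · exact Tmax.indep (Tmax.down_closed (addedTriangles_subset ξ T Tmax ht).1 hst hs)
  inter_subset_convexHull := by
    have hsub : ∀ s ∈ T.faces ∪ {s | s.Nonempty ∧ ∃ t ∈ addedTriangles ξ T Tmax, s ⊆ t},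
        s ∈ Tmax.faces := by
      rintro s (hs | ⟨hs, t, ht, hst⟩)
      · exact hle hs
      · exact Tmax.down_closed (addedTriangles_subset ξ T Tmax ht).1 hst hs
    exact fun {s t} hs ht => Tmax.inter_subset_convexHull (hsub _ hs) (hsub _ ht)

theorem le_stableHull (ξ : ℝ) {T Tmax : Complex2} (hle : T ≤ Tmax) : T ≤ stableHull ξ hle :=
  fun _ hs => Or.inl hs

theorem stableHull_le (ξ : ℝ) {T Tmax : Complex2} (hle : T ≤ Tmax) : stableHull ξ hle ≤ Tmax := by
  rintro s (hs | ⟨hs, t, ht, hst⟩)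
  · exact hle hs
  · exact Tmax.down_closed (addedTriangles_subset ξ T Tmax ht).1 hst hs

/-- All triangles of `Tmax` at an unstable edge of the hull belong to the hull, and there are two
of them. -/
theorem isStable_of_isBoundaryEdge {η ξ : ℝ} (hη : 0 < η) {S : Set Plane} (hS : IsGromov η S)
    {T Tmax : Complex2} (hT : IsDelaunay Tmax S) (hle : T ≤ Tmax) {a b : Plane}
    (hab : IsBoundaryEdge (stableHull ξ hle) a b) : IsStable ξ Tmax.vertices a b := by
  by_contra hst
  obtain ⟨⟨hne, e, he, hecoe⟩, hsub⟩ := hab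
  have hae : a ∈ e := Finset.mem_coe.1 (hecoe ▸ by simp)
  have hbe : b ∈ e := Finset.mem_coe.1 (hecoe ▸ by simp)
  obtain ⟨t, ht, t', ht', htt, hat, hbt, hat', hbt'⟩ := hT.exists_two_triangles hη hS.1
    (hS.isNet hη) (hasEdge_of_mem_face (stableHull_le ξ hle he) hne hae hbe)
  have hadd : ∀ u ∈ triangles Tmax, a ∈ u → b ∈ u → u ∈ addedTriangles ξ T Tmax := by
    intro u hu hau hbu
    rcases he with he | ⟨_, s, hs, hes⟩
    · exact ⟨a, b, ⟨hne, e, he, hecoe⟩, hst, u, hu, hau, hbu, Relation.ReflTransGen.refl⟩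
    · have hs3 := addedTriangles_subset ξ T Tmax hs
      obtain ⟨a', b', h1, h2, t₀, ht₀, h3, h4, hchain⟩ := hs
      exact ⟨a', b', h1, h2, t₀, ht₀, h3, h4,
        hchain.tail ⟨hs3, hu, a, b, hne, hes hae, hes hbe, hau, hbu, hst⟩⟩
  have hface : ∀ u ∈ triangles Tmax, a ∈ u → b ∈ u → u ∈ (stableHull ξ hle).faces :=
    fun u hu hau hbu => Or.inr ⟨⟨a, hau⟩, u, hadd u hu hau hbu, subset_rfl⟩
  exact htt (hsub ⟨hface t ht hat hbt, ht.2, hat, hbt⟩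
    ⟨hface t' ht' hat' hbt', ht'.2, hat', hbt'⟩)

end CDG

theorem mainTheorem7 :
    ∃ ξ : ℝ, 0 < ξ ∧
      ∀ (η : ℝ), 0 < η →
      ∀ (T Tmax : CDG.Complex2),
        CDG.IsCDG η T → CDG.IsMaximalCDG η Tmax → T ≤ Tmax →
        ∃ Tst : CDG.Complex2,
          CDG.IsCDG η Tst ∧ T ≤ Tst ∧ Tst ≤ Tmax ∧
          Tst.space ⊆ Metric.thickening (2 * η) T.space ∧
          ∀ a b : CDG.Plane, CDG.IsBoundaryEdge Tst a b →
            CDG.IsStable (ξ * η) Tmax.vertices a b := by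
  obtain ⟨ξ, hξ, hdrift⟩ := CDG.exists_dist_circumcenter_le
  refine ⟨ξ, hξ, fun η hη T Tmax _ hTmax hle => ?_⟩
  obtain ⟨S, hS, hT⟩ := id hTmax
  refine ⟨CDG.stableHull (ξ * η) hle, ⟨Tmax, hTmax, CDG.stableHull_le _ hle⟩,
    CDG.le_stableHull _ hle, CDG.stableHull_le _ hle, ?_,
    fun a b hab => CDG.isStable_of_isBoundaryEdge hη hS hT hle hab⟩
  intro x hx
  obtain ⟨s, hs, hxs⟩ := (CDG.stableHull (ξ * η) hle).mem_space_iff.1 hx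
  rw [Metric.mem_thickening_iff]
  rcases hs with hs | ⟨_, t, ht, hst⟩
  · exact ⟨x, T.mem_space_iff.2 ⟨s, hs, hxs⟩, by rw [dist_self]; positivity⟩
  -- The midpoint of the edge from which the chain of `t` starts is near enough.
  have ht3 := CDG.addedTriangles_subset _ _ _ ht
  obtain ⟨a, b, ⟨hab, e, he, hecoe⟩, _, t₀, ht₀, hat₀, hbt₀, hchain⟩ := ht
  obtain ⟨c₀, c, r₀, r, hc₀, hc, hcc⟩ := hdrift η hη S hS Tmax hT t₀ ht₀ t hchain
  have hnet := hS.isNet hη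
  have hr₀ := hT.radius_lt hnet ht₀.1 ht₀.2 hc₀
  have hr := hT.radius_lt hnet ht3.1 ht3.2 hc
  have hxc := CDG.convexHull_subset_closedBall hc (convexHull_mono (Finset.coe_subset.2 hst) hxs)
  rw [Metric.mem_closedBall] at hxc
  have hmem : ∀ v ∈ t₀, v ∈ S := fun v hv => hT.1.1 ▸ CDG.mem_vertices_of_mem_face ht₀.1 hv
  have hmid := CDG.dist_midpoint_center_le hη (hS.1 (hmem a hat₀) (hmem b hbt₀) hab)
    ((hc₀ a hat₀).trans (hc₀ b hbt₀).symm) ((hc₀ a hat₀).trans_le hr₀.le)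
  refine ⟨midpoint ℝ a b, T.mem_space_iff.2 ⟨e, he, ?_⟩, ?_⟩
  · rw [hecoe, convexHull_pair]
    exact midpoint_mem_segment a b
  · have h := dist_triangle4 x c c₀ (midpoint ℝ a b)
    rw [dist_comm c₀] at h
    linarith
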